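/- A Cantor base is a sequence $\boldsymbol\beta=(\beta_n)_{n\in\mathbb N}$ of real numbers greater than $1$ with $\prod_{n}\beta_n=+\infty$. It is an alternate base of length $p\ge 1$ if $\beta_{n+p}=\beta_n$ for all $n\in\mathbb N$. For such a base put $\boldsymbol\beta^{(n)}=(\beta_n,\beta_{n+1},\ldots)$ and $$x_{\boldsymbol\beta}=\sum_{n\in\mathbb N}\frac{\lceil\beta_n\rceil-1}{\prod_{k=0}^n\beta_k}<+\infty .$$ For $x\in(x_{\boldsymbol\beta}-1,x_{\boldsymbol\beta}]$ the lazy $\boldsymbol\beta$-expansion $\ell_{\boldsymbol\beta}(x)=\xi_0\xi_1\xi_2\cdots$ is defined recursively: $\xi_N$ is the least element of $\{0,\ldots,\lceil\beta_N\rceil-1\}$ such that $$\sum_{n=0}^N\frac{\xi_n}{\prod_{k=0}^n\beta_k}+\sum_{n=N+1}^{+\infty}\frac{\lceil\beta_n\rceil-1}{\prod_{k=0}^n\beta_k}\ge x .$$ The quasi-lazy $\boldsymbol\beta$-expansion of $x_{\boldsymbol\beta}-1$ is $\ell^*_{\boldsymbol\beta}(x_{\boldsymbol\beta}-1)=\lim_{x\to(x_{\boldsymbol\beta}-1)^+}\ell_{\boldsymbol\beta}(x)$,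 the limit being taken for the prefix distance on infinite words. Let $D'_{\boldsymbol\beta}=\{\ell_{\boldsymbol\beta}(x): x\in(x_{\boldsymbol\beta}-1,x_{\boldsymbol\beta}]\}$. The lazy $\boldsymbol\beta$-shift $\Sigma'_{\boldsymbol\beta}$ is the topological closure of $\bigcup_{n\in\mathbb N}D'_{\boldsymbol\beta^{(n)}}$ in $A_{\boldsymbol\beta}^{\mathbb N}$, where $A_{\boldsymbol\beta}=\{0,\ldots,\sup_n(\lceil\beta_n\rceil-1)\}$. A subshift is sofic if the language of finite factors of its elements is accepted by a finite automaton. **Theorem.** Let $\boldsymbol\beta$ be an alternate base of length $p$. The lazy $\boldsymbol\beta$-shift $\Sigma'_{\boldsymbol\beta}$ is sofic if and only if for every $i\in\{0,\ldots,p-1\}$ the quasi-lazy expansion $\ell^*_{\boldsymbol\beta^{(i)}}(x_{\boldsymbol\beta^{(i)}}-1)$ is ultimately periodic. -/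

import Mathlib

open Filter Topology

namespace LazyBeta

/-- A Cantor real base: a sequence of reals greater than `1` whose infinite product diverges. -/
def IsCantorBase (β : ℕ → ℝ) : Prop :=
  (∀ n, 1 < β n) ∧ Tendsto (fun n => ∏ k ∈ Finset.range n, β k) atTop atTop

/-- An alternate base of length `p`: a Cantor base with (not necessarily minimal) period `p ≥ 1`. -/
def IsAlternateBase (β : ℕ → ℝ) (p : ℕ) : Prop :=
  IsCantorBase β ∧ 1 ≤ p ∧ ∀ n, β (n + p) = β n

/-- The shifted base `β^(n) = (β_n, β_{n+1}, …)`. -/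
def shiftBase (β : ℕ → ℝ) (n : ℕ) : ℕ → ℝ := fun k => β (n + k)

/-- The largest digit `⌈β_n⌉ - 1` allowed at position `n`. -/
noncomputable def maxDigit (β : ℕ → ℝ) (n : ℕ) : ℕ := ⌈β n⌉₊ - 1

/-- The denominator `β_0 β_1 ⋯ β_n` of the digit at position `n`. -/
noncomputable def denom (β : ℕ → ℝ) (n : ℕ) : ℝ := ∏ k ∈ Finset.range (n + 1), β k

/-- The number `x_β = ∑_n (⌈β_n⌉ - 1) / (β_0 ⋯ β_n)`; the series converges for alternate bases. -/
noncomputable def xMax (β : ℕ → ℝ) : ℝ := ∑' n, (maxDigit β n : ℝ) / denom β n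

/-- The tail `∑_{n > N} (⌈β_n⌉ - 1) / (β_0 ⋯ β_n)` of the series defining `x_β`. -/
noncomputable def xTail (β : ℕ → ℝ) (N : ℕ) : ℝ :=
  ∑' n, (maxDigit β (N + 1 + n) : ℝ) / denom β (N + 1 + n)

/-- One step of the lazy algorithm: if the digits at positions below `N` contribute `S`, the digit
at position `N` is the least `d` in `{0, …, ⌈β_N⌉ - 1}` such that
`S + d / (β_0 ⋯ β_N) + ∑_{n > N} (⌈β_n⌉ - 1) / (β_0 ⋯ β_n) ≥ x`. -/
noncomputable def lazyStep (β : ℕ → ℝ) (x : ℝ) (N : ℕ) (S : ℝ) : ℕ :=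
  sInf {d : ℕ | d ≤ maxDigit β N ∧ S + (d : ℝ) / denom β N + xTail β N ≥ x}

/-- The contribution of the first `N` lazy digits of `x`. -/
noncomputable def lazyPartialSum (β : ℕ → ℝ) (x : ℝ) : ℕ → ℝ
  | 0 => 0
  | N + 1 => lazyPartialSum β x N +
      (lazyStep β x N (lazyPartialSum β x N) : ℝ) / denom β N

/-- The lazy expansion `ℓ_β(x)` (meaningful for `x ∈ (x_β - 1, x_β]`). -/
noncomputable def lazyExpansion (β : ℕ → ℝ) (x : ℝ) : ℕ → ℕ :=
  fun N => lazyStep β x N (lazyPartialSum β x N)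

theorem lazyPartialSum_eq (β : ℕ → ℝ) (x : ℝ) (N : ℕ) :
    lazyPartialSum β x N =
      ∑ n ∈ Finset.range N, (lazyExpansion β x n : ℝ) / denom β n := by
  induction N with
  | zero => simp [lazyPartialSum]
  | succ N ih => rw [Finset.sum_range_succ, ← ih]; rfl

theorem lazyExpansion_le_maxDigit (β : ℕ → ℝ) (x : ℝ) (N : ℕ) :
    lazyExpansion β x N ≤ maxDigit β N := by
  unfold lazyExpansion lazyStep
  rcases Set.eq_empty_or_nonempty
    {d : ℕ | d ≤ maxDigit β N ∧
      lazyPartialSum β x N + (d : ℝ) / denom β N + xTail β N ≥ x} with h | h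
  · simp [h]
  · exact (Nat.sInf_mem h).1

/-- The word `a` is the quasi-lazy expansion `ℓ*_β(x_β - 1)`, that is, the limit of `ℓ_β(x)` as `x`
tends to `x_β - 1` from the right. Infinite words carry the product of the discrete topologies,
which is the topology of the prefix distance. -/
def IsQuasiLazyExpansion (β : ℕ → ℝ) (a : ℕ → ℕ) : Prop :=
  Tendsto (lazyExpansion β) (𝓝[>] (xMax β - 1)) (𝓝 a)

/-- An infinite word is ultimately periodic. -/
def IsUltimatelyPeriodic {α : Type*} (a : ℕ → α) : Prop :=
  ∃ m n : ℕ, 1 ≤ n ∧ ∀ k, m ≤ k → a (k + n) = a k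

/-- The alphabet `A_β = {0, …, sup_n (⌈β_n⌉ - 1)}`. -/
abbrev Alphabet (β : ℕ → ℝ) : Type := {d : ℕ // ∃ n, d ≤ maxDigit β n}

/-- The set `D'_β` of lazy expansions of the reals in `(x_β - 1, x_β]`. -/
def lazyExpansions (β : ℕ → ℝ) : Set (ℕ → ℕ) :=
  lazyExpansion β '' Set.Ioc (xMax β - 1) (xMax β)

/-- The union `Δ'_β` of the sets `D'_{β^(n)}`, as a set of infinite words over `A_β`. -/
def lazyUnion (β : ℕ → ℝ) : Set (ℕ → Alphabet β) :=
  {a | ∃ n, (fun k => (a k : ℕ)) ∈ lazyExpansions (shiftBase β n)}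

/-- The lazy `β`-shift `Σ'_β`, the topological closure of `Δ'_β`. -/
def lazyShift (β : ℕ → ℝ) : Set (ℕ → Alphabet β) := closure (lazyUnion β)

/-- The language `Fac(S)` of finite factors of the infinite words in `S`. -/
def factorLanguage {α : Type*} (S : Set (ℕ → α)) : Language α :=
  {w | ∃ a ∈ S, ∃ m n : ℕ, w = List.ofFn (fun k : Fin n => a (m + k))}

/-- A subshift is sofic if its language of factors is accepted by a finite automaton. -/
def IsSofic {α : Type*} (S : Set (ℕ → α)) : Prop := (factorLanguage S).IsRegular

end LazyBeta

namespace LazyBeta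

/-! Writing `x = xMax β - y` with `y` in `[0, 1)`, the lazy digits of `x` are the complements of the
greedy digits of `y`, and the quasi-lazy expansion is the complement of the quasi-greedy expansion
of `1`. The factors of the lazy shift are thus the union, over the phases `i < p`, of the languages
`L_i(1)`, where `L_i(r)` is `prefixLanguage β i r`.

Reading a letter whose complement is `c` moves the threshold `r` to `β i * r - c`, which matters
only up to truncation to `[0, 1]`. So a quotient of `L_i(r)` by a letter is empty, `L_{i+1}(1)`, or
`L_{i+1}` of the quasi-greedy image of `r` (`leftQuotient_singleton_cases`). Since the base is
expanding, `r ↦ L_i(r)` is injective on `(0, 1]`, and the languages along the quasi-greedy orbit of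
`1` are finitely many exactly when its digits are ultimately periodic
(`finite_range_quasiLanguage_iff`). The Myhill–Nerode criterion then gives regularity from
periodicity.

For the converse, the union over phases might merge quotients. A word admissible in as few phases as
possible, followed by a long block of greedy zeros, has `L_j(1)` itself as its quotient
(`exists_leftQuotient_totalLanguage_eq`), so regularity bounds the quotients of each `L_j(1)`. -/

/-- The orbit of `y` under a nonautonomous dynamical system `f`, started at time `i`. -/
def orbit (f : ℕ → ℝ → ℝ) : ℕ → ℕ → ℝ → ℝ
  | 0, _, y => y
  | n + 1, i, y => orbit f n (i + 1) (f i y)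

theorem orbit_succ (f : ℕ → ℝ → ℝ) (n i : ℕ) (y : ℝ) :
    orbit f (n + 1) i y = f (i + n) (orbit f n i y) := by
  induction n generalizing i y with
  | zero => rfl
  | succ n ih =>
    rw [orbit, ih, orbit, show i + 1 + n = i + (n + 1) by ring]

theorem orbit_add_period {f : ℕ → ℝ → ℝ} {p : ℕ} (hf : ∀ i, f (i + p) = f i) (n i : ℕ) (y : ℝ) :
    orbit f n (i + p) y = orbit f n i y := by
  induction n generalizing i y with
  | zero => rfl
  | succ n ih => rw [orbit, orbit, hf, show i + p + 1 = i + 1 + p by ring, ih]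

/-! ### Greedy and quasi-greedy transformations. -/

/-- The greedy digit of `y` at time `i`. -/
noncomputable def greedyDigit (β : ℕ → ℝ) (i : ℕ) (y : ℝ) : ℕ := ⌊β i * y⌋₊

/-- The greedy transformation at time `i`. -/
noncomputable def greedyNext (β : ℕ → ℝ) (i : ℕ) (y : ℝ) : ℝ := β i * y - greedyDigit β i y

/-- The quasi-greedy digit of `r` at time `i`. -/
noncomputable def quasiDigit (β : ℕ → ℝ) (i : ℕ) (r : ℝ) : ℕ := ⌈β i * r⌉₊ - 1

/-- The quasi-greedy transformation at time `i`. -/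
noncomputable def quasiNext (β : ℕ → ℝ) (i : ℕ) (r : ℝ) : ℝ := β i * r - quasiDigit β i r

/-- The word complementary to the greedy expansion of `y` in base `β^(i)`. -/
noncomputable def lazyWord (β : ℕ → ℝ) (i : ℕ) (y : ℝ) (k : ℕ) : ℕ :=
  maxDigit β (i + k) - greedyDigit β (i + k) (orbit (greedyNext β) k i y)

/-- The word complementary to the quasi-greedy expansion of `r` in base `β^(i)`. -/
noncomputable def quasiLazyWord (β : ℕ → ℝ) (i : ℕ) (r : ℝ) (k : ℕ) : ℕ :=
  maxDigit β (i + k) - quasiDigit β (i + k) (orbit (quasiNext β) k i r)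

section Digits

variable {β : ℕ → ℝ}

theorem maxDigit_add_one (hβ : ∀ n, 1 < β n) (i : ℕ) : maxDigit β i + 1 = ⌈β i⌉₊ := by
  have : 0 < ⌈β i⌉₊ := Nat.ceil_pos.2 (by linarith [hβ i])
  unfold maxDigit
  omega

theorem le_maxDigit_iff (hβ : ∀ n, 1 < β n) (i d : ℕ) : d ≤ maxDigit β i ↔ (d : ℝ) < β i := by
  rw [← Nat.lt_ceil, ← maxDigit_add_one hβ, Nat.lt_succ_iff]

theorem greedyNext_mem (hβ : ∀ n, 1 < β n) (i : ℕ) {y : ℝ} (hy : y ∈ Set.Ico (0 : ℝ) 1) :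
    greedyNext β i y ∈ Set.Ico (0 : ℝ) 1 := by
  have h0 : 0 ≤ β i * y := mul_nonneg (by linarith [hβ i]) hy.1
  have h1 := Nat.floor_le h0
  have h2 := Nat.lt_floor_add_one (β i * y)
  unfold greedyNext greedyDigit
  constructor <;> linarith

theorem greedyDigit_le_maxDigit (hβ : ∀ n, 1 < β n) (i : ℕ) {y : ℝ}
    (hy : y ∈ Set.Ico (0 : ℝ) 1) : greedyDigit β i y ≤ maxDigit β i := by
  have hb := hβ i
  rw [le_maxDigit_iff hβ]
  have h1 := Nat.floor_le (mul_nonneg (by linarith : 0 ≤ β i) hy.1)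
  unfold greedyDigit
  nlinarith [hy.2]

theorem greedyOrbit_mem (hβ : ∀ n, 1 < β n) (n i : ℕ) {y : ℝ} (hy : y ∈ Set.Ico (0 : ℝ) 1) :
    orbit (greedyNext β) n i y ∈ Set.Ico (0 : ℝ) 1 := by
  induction n generalizing i y with
  | zero => exact hy
  | succ n ih => exact ih _ (greedyNext_mem hβ i hy)

theorem greedyDigit_div (hβ : ∀ n, 1 < β n) (i d : ℕ) {t : ℝ} (ht : t ∈ Set.Ico (0 : ℝ) 1) :
    greedyDigit β i ((d + t) / β i) = d := by
  have hb := hβ i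
  unfold greedyDigit
  rw [mul_div_cancel₀ _ (by linarith), Nat.floor_eq_iff (by linarith [ht.1, d.cast_nonneg (α := ℝ)])]
  exact ⟨by linarith [ht.1], by linarith [ht.2]⟩

theorem greedyNext_div (hβ : ∀ n, 1 < β n) (i d : ℕ) {t : ℝ} (ht : t ∈ Set.Ico (0 : ℝ) 1) :
    greedyNext β i ((d + t) / β i) = t := by
  have hb := hβ i
  unfold greedyNext
  rw [greedyDigit_div hβ i d ht, mul_div_cancel₀ _ (by linarith)]
  ring

theorem eq_digit_add_greedyNext_div (hβ : ∀ n, 1 < β n) (i : ℕ) (y : ℝ) :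
    y = (greedyDigit β i y + greedyNext β i y) / β i := by
  have hb := hβ i
  unfold greedyNext
  field_simp
  ring

theorem quasiDigit_add_one (hβ : ∀ n, 1 < β n) (i : ℕ) {r : ℝ} (hr : 0 < r) :
    quasiDigit β i r + 1 = ⌈β i * r⌉₊ := by
  have : 0 < ⌈β i * r⌉₊ := Nat.ceil_pos.2 (mul_pos (by linarith [hβ i]) hr)
  unfold quasiDigit
  omega

theorem quasiNext_mem (hβ : ∀ n, 1 < β n) (i : ℕ) {r : ℝ} (hr : r ∈ Set.Ioc (0 : ℝ) 1) :
    quasiNext β i r ∈ Set.Ioc (0 : ℝ) 1 := by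
  have h := quasiDigit_add_one hβ i hr.1
  have h1 := Nat.le_ceil (β i * r)
  have h2 := Nat.ceil_lt_add_one (mul_pos (by linarith [hβ i] : 0 < β i) hr.1).le
  rw [← h] at h1 h2
  push_cast at h1 h2
  unfold quasiNext
  constructor <;> linarith

theorem quasiDigit_eq (hβ : ∀ n, 1 < β n) (i d : ℕ) {r : ℝ} (hr : 0 < r)
    (h0 : (d : ℝ) < β i * r) (h1 : β i * r ≤ d + 1) : quasiDigit β i r = d := by
  have h := quasiDigit_add_one hβ i hr
  have : ⌈β i * r⌉₊ = d + 1 := by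
    rw [Nat.ceil_eq_iff (by omega)]
    exact ⟨by simpa using h0, by push_cast; exact h1⟩
  omega

theorem quasiDigit_le_maxDigit (hβ : ∀ n, 1 < β n) (i : ℕ) {r : ℝ} (hr : r ∈ Set.Ioc (0 : ℝ) 1) :
    quasiDigit β i r ≤ maxDigit β i := by
  have hb := hβ i
  rw [le_maxDigit_iff hβ]
  have h1 := (quasiNext_mem hβ i hr).1
  unfold quasiNext at h1
  nlinarith [hr.2]

theorem quasiOrbit_mem (hβ : ∀ n, 1 < β n) (n i : ℕ) {r : ℝ} (hr : r ∈ Set.Ioc (0 : ℝ) 1) :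
    orbit (quasiNext β) n i r ∈ Set.Ioc (0 : ℝ) 1 := by
  induction n generalizing i r with
  | zero => exact hr
  | succ n ih => exact ih _ (quasiNext_mem hβ i hr)

theorem maxDigit_add_period {p : ℕ} (hp : ∀ n, β (n + p) = β n) (i : ℕ) :
    maxDigit β (i + p) = maxDigit β i := by
  unfold maxDigit; rw [hp]

theorem greedyNext_add_period {p : ℕ} (hp : ∀ n, β (n + p) = β n) (i : ℕ) :
    greedyNext β (i + p) = greedyNext β i := by
  unfold greedyNext greedyDigit; simp only [hp]

theorem quasiNext_add_period {p : ℕ} (hp : ∀ n, β (n + p) = β n) (i : ℕ) :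
    quasiNext β (i + p) = quasiNext β i := by
  unfold quasiNext quasiDigit; simp only [hp]

theorem eq_mod_of_periodic {α : Type*} {p : ℕ} {f : ℕ → α} (hf : ∀ i, f (i + p) = f i) (i : ℕ) :
    f i = f (i % p) :=
  (Function.Periodic.map_mod_nat hf i).symm

/-- An alternate base is bounded away from `1`. -/
theorem exists_one_lt_forall_le {p : ℕ} (hβ : ∀ n, 1 < β n) (hp1 : 1 ≤ p)
    (hp : ∀ n, β (n + p) = β n) : ∃ b, 1 < b ∧ ∀ n, b ≤ β n := by
  obtain ⟨j, -, hj⟩ := (Finset.range p).exists_min_image β ⟨0, Finset.mem_range.2 hp1⟩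
  refine ⟨β j, hβ j, fun n => ?_⟩
  rw [eq_mod_of_periodic hp n]
  exact hj _ (by simpa using Nat.mod_lt _ hp1)

theorem exists_maxDigit_le {p : ℕ} (hp1 : 1 ≤ p)
    (hp : ∀ n, β (n + p) = β n) : ∃ M : ℕ, ∀ n, maxDigit β n ≤ M := by
  obtain ⟨j, -, hj⟩ := (Finset.range p).exists_max_image (maxDigit β) ⟨0, Finset.mem_range.2 hp1⟩
  refine ⟨maxDigit β j, fun n => ?_⟩
  rw [eq_mod_of_periodic (maxDigit_add_period hp) n]
  exact hj _ (by simpa using Nat.mod_lt _ hp1)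

end Digits

/-! ### Prefix languages and their left quotients. -/

section Prefixes

variable {β : ℕ → ℝ}

/-- The word `w` is a prefix of the complement of the greedy expansion of `y` in base `β^(i)`. -/
def IsLazyPrefix (β : ℕ → ℝ) : List (Alphabet β) → ℕ → ℝ → Prop
  | [], _, _ => True
  | d :: w, i, y =>
    (d : ℕ) = maxDigit β i - greedyDigit β i y ∧ IsLazyPrefix β w (i + 1) (greedyNext β i y)

theorem isLazyPrefix_append (u v : List (Alphabet β)) (i : ℕ) (y : ℝ) :
    IsLazyPrefix β (u ++ v) i y ↔
      IsLazyPrefix β u i y ∧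
        IsLazyPrefix β v (i + u.length) (orbit (greedyNext β) u.length i y) := by
  induction u generalizing i y with
  | nil => simp [IsLazyPrefix, orbit]
  | cons d u ih =>
    rw [List.cons_append, IsLazyPrefix, ih, IsLazyPrefix, List.length_cons, orbit, and_assoc,
      show i + 1 + u.length = i + (u.length + 1) by ring]

theorem isLazyPrefix_add_period {p : ℕ} (hp : ∀ n, β (n + p) = β n) (w : List (Alphabet β))
    (i : ℕ) (y : ℝ) : IsLazyPrefix β w (i + p) y ↔ IsLazyPrefix β w i y := by
  induction w generalizing i y with
  | nil => rfl
  | cons d w ih =>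
    rw [IsLazyPrefix, IsLazyPrefix, maxDigit_add_period hp, greedyNext_add_period hp,
      show i + p + 1 = i + 1 + p by ring, ih]
    simp only [greedyDigit, hp]

theorem isLazyPrefix_iff_forall (w : List (Alphabet β)) (i : ℕ) (y : ℝ) :
    IsLazyPrefix β w i y ↔ ∀ k (h : k < w.length), (w[k] : ℕ) = lazyWord β i y k := by
  induction w generalizing i y with
  | nil => simp [IsLazyPrefix]
  | cons d w ih =>
    rw [IsLazyPrefix, ih]
    have key : ∀ k, lazyWord β (i + 1) (greedyNext β i y) k = lazyWord β i y (k + 1) := fun k => by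
      unfold lazyWord
      rw [orbit, show i + 1 + k = i + (k + 1) by ring]
    constructor
    · rintro ⟨h0, h⟩ (_ | k) hk
      · exact h0
      · simpa [key] using h k (by simpa using hk)
    · intro h
      refine ⟨h 0 (by simp), fun k hk => ?_⟩
      rw [key]
      exact h (k + 1) (by simpa using hk)

/-- As long as the digits agree, each step multiplies the distance of the two orbits by some `β i ≥
b`, while both stay in `[0, 1)`. -/
theorem IsLazyPrefix.abs_sub_mul_pow_lt {b : ℝ} (hb : 1 < b) (hβ : ∀ n, b ≤ β n)
    {w : List (Alphabet β)} {i : ℕ} {y z : ℝ}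
    (hy : y ∈ Set.Ico (0 : ℝ) 1) (hz : z ∈ Set.Ico (0 : ℝ) 1)
    (hwy : IsLazyPrefix β w i y) (hwz : IsLazyPrefix β w i z) :
    |y - z| * b ^ w.length < 1 := by
  have hβ1 : ∀ n, 1 < β n := fun n => hb.trans_le (hβ n)
  induction w generalizing i y z with
  | nil =>
    simp only [List.length_nil, pow_zero, mul_one, abs_lt]
    constructor <;> linarith [hy.1, hy.2, hz.1, hz.2]
  | cons d w ih =>
    have h := ih (greedyNext_mem hβ1 i hy) (greedyNext_mem hβ1 i hz) hwy.2 hwz.2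
    have e : greedyDigit β i y = greedyDigit β i z := by
      have h1 := greedyDigit_le_maxDigit hβ1 i hy
      have h2 := greedyDigit_le_maxDigit hβ1 i hz
      have h3 := hwy.1.symm.trans hwz.1
      omega
    have e' : greedyNext β i y - greedyNext β i z = β i * (y - z) := by
      unfold greedyNext
      rw [e]
      ring
    rw [e', abs_mul, abs_of_pos (by linarith [hβ1 i])] at h
    refine lt_of_le_of_lt ?_ h
    rw [List.length_cons, pow_succ]
    have h1 : 0 ≤ |y - z| * b ^ w.length := by positivity
    nlinarith [hβ i]

/-- The words that are prefixes of the complement of the greedy expansion of a point of `[0, r)`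
in base `β^(i)`. -/
def prefixLanguage (β : ℕ → ℝ) (i : ℕ) (r : ℝ) : Language (Alphabet β) :=
  {w | ∃ y ∈ Set.Ico (0 : ℝ) 1, y < r ∧ IsLazyPrefix β w i y}

theorem mem_prefixLanguage {i : ℕ} {r : ℝ} {w : List (Alphabet β)} :
    w ∈ prefixLanguage β i r ↔ ∃ y ∈ Set.Ico (0 : ℝ) 1, y < r ∧ IsLazyPrefix β w i y := Iff.rfl

theorem prefixLanguage_add_period {p : ℕ} (hp : ∀ n, β (n + p) = β n) (i : ℕ) :
    prefixLanguage β (i + p) = prefixLanguage β i := by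
  ext r w
  simp only [mem_prefixLanguage, isLazyPrefix_add_period hp]

/-- On the points with greedy digit `c` the transformation is the increasing affine map `y ↦ β i * y
- c`, so the bound `r` is carried to `β i * r - c`. The new bound may be negative or exceed `1`. -/
theorem cons_mem_prefixLanguage (hβ : ∀ n, 1 < β n) {i : ℕ} {r : ℝ} (hr : r ≤ 1)
    (d : Alphabet β) (w : List (Alphabet β)) :
    d :: w ∈ prefixLanguage β i r ↔
      (d : ℕ) ≤ maxDigit β i ∧
        w ∈ prefixLanguage β (i + 1) (β i * r - (maxDigit β i - d : ℕ)) := by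
  have hb := hβ i
  rw [mem_prefixLanguage, mem_prefixLanguage]
  constructor
  · rintro ⟨y, hy, hyr, h0, h⟩
    have h1 := greedyDigit_le_maxDigit hβ i hy
    have e : maxDigit β i - (d : ℕ) = greedyDigit β i y := by omega
    refine ⟨by omega, greedyNext β i y, greedyNext_mem hβ i hy, ?_, h⟩
    rw [e]
    unfold greedyNext
    nlinarith
  · rintro ⟨hd, t, ht, htr, h⟩
    have hlt : ((maxDigit β i - d : ℕ) + t) / β i < r := by
      rw [div_lt_iff₀ (by linarith)]
      linarith
    refine ⟨((maxDigit β i - d : ℕ) + t) / β i, ⟨?_, hlt.trans_le hr⟩, hlt, ?_, ?_⟩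
    · exact div_nonneg (add_nonneg (Nat.cast_nonneg _) ht.1) (by linarith)
    · rw [greedyDigit_div hβ i _ ht]; omega
    · rwa [greedyNext_div hβ i _ ht]

theorem prefixLanguage_of_one_le {i : ℕ} {r : ℝ} (hr : 1 ≤ r) :
    prefixLanguage β i r = prefixLanguage β i 1 := by
  ext w
  rw [mem_prefixLanguage, mem_prefixLanguage]
  exact ⟨fun ⟨y, hy, _, h⟩ => ⟨y, hy, hy.2, h⟩, fun ⟨y, hy, _, h⟩ => ⟨y, hy, hy.2.trans_le hr, h⟩⟩

theorem prefixLanguage_of_nonpos {i : ℕ} {r : ℝ} (hr : r ≤ 0) :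
    prefixLanguage β i r = 0 := by
  ext w
  simp only [mem_prefixLanguage, Language.notMem_zero, iff_false]
  rintro ⟨y, hy, h, -⟩
  linarith [hy.1]

theorem leftQuotient_singleton_cases (hβ : ∀ n, 1 < β n) (i : ℕ) {r : ℝ}
    (hr : r ∈ Set.Ioc (0 : ℝ) 1) (d : Alphabet β) :
    (prefixLanguage β i r).leftQuotient [d] = 0 ∨
      (prefixLanguage β i r).leftQuotient [d] = prefixLanguage β (i + 1) 1 ∨
      (prefixLanguage β i r).leftQuotient [d] = prefixLanguage β (i + 1) (quasiNext β i r) := by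
  by_cases hd : (d : ℕ) ≤ maxDigit β i
  · have e : (prefixLanguage β i r).leftQuotient [d] =
        prefixLanguage β (i + 1) (β i * r - (maxDigit β i - d : ℕ)) := by
      ext w
      rw [Language.mem_leftQuotient, List.singleton_append, cons_mem_prefixLanguage hβ hr.2]
      simp [hd]
    rw [e]
    rcases le_or_gt (β i * r - (maxDigit β i - d : ℕ)) 0 with h0 | h0
    · exact .inl (prefixLanguage_of_nonpos h0)
    rcases le_or_gt 1 (β i * r - (maxDigit β i - d : ℕ)) with h1 | h1
    · exact .inr (.inl (prefixLanguage_of_one_le h1))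
    · refine .inr (.inr ?_)
      -- A new threshold strictly between `0` and `1` forces the complement of `d` to be the
      -- quasi-greedy digit of `r`.
      rw [quasiNext, quasiDigit_eq hβ i (maxDigit β i - d) hr.1 (by linarith) (by linarith)]
  · left
    ext w
    rw [Language.mem_leftQuotient, List.singleton_append, cons_mem_prefixLanguage hβ hr.2]
    simp [hd, Language.notMem_zero]

theorem leftQuotient_singleton_quasiDigit (hβ : ∀ n, 1 < β n) (i : ℕ) {r : ℝ}
    (hr : r ∈ Set.Ioc (0 : ℝ) 1) (d : Alphabet β)
    (hd : (d : ℕ) = maxDigit β i - quasiDigit β i r) :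
    (prefixLanguage β i r).leftQuotient [d] = prefixLanguage β (i + 1) (quasiNext β i r) := by
  have h := quasiDigit_le_maxDigit hβ i hr
  ext w
  rw [Language.mem_leftQuotient, List.singleton_append, cons_mem_prefixLanguage hβ hr.2, quasiNext,
    show maxDigit β i - (d : ℕ) = quasiDigit β i r by omega]
  simp only [and_iff_right_iff_imp]
  omega

/-- The languages `prefixLanguage β (j + n) r_n`, where `(r_n)` is the quasi-greedy orbit of `1` in
base `β^(j)`. -/
def quasiLanguage (β : ℕ → ℝ) (j n : ℕ) : Language (Alphabet β) :=
  prefixLanguage β (j + n) (orbit (quasiNext β) n j 1)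

theorem leftQuotient_quasiLanguage_singleton (hβ : ∀ n, 1 < β n) (j n : ℕ) (d : Alphabet β) :
    (quasiLanguage β j n).leftQuotient [d] = 0 ∨
      ∃ j' n', (quasiLanguage β j n).leftQuotient [d] = quasiLanguage β j' n' := by
  have hr : orbit (quasiNext β) n j 1 ∈ Set.Ioc (0 : ℝ) 1 := quasiOrbit_mem hβ n j (by simp)
  rcases leftQuotient_singleton_cases hβ (j + n) hr d with h | h | h
  · exact .inl h
  -- A saturated threshold restarts the quasi-greedy orbit of `1`, now in the base shifted to the
  -- current time.
  · exact .inr ⟨j + n + 1, 0, h⟩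
  · refine .inr ⟨j, n + 1, h.trans ?_⟩
    rw [quasiLanguage, orbit_succ, add_assoc]

theorem leftQuotient_quasiLanguage (hβ : ∀ n, 1 < β n) (w : List (Alphabet β)) (j n : ℕ) :
    (quasiLanguage β j n).leftQuotient w = 0 ∨
      ∃ j' n', (quasiLanguage β j n).leftQuotient w = quasiLanguage β j' n' := by
  induction w generalizing j n with
  | nil => exact .inr ⟨j, n, rfl⟩
  | cons d w ih =>
    rw [← List.singleton_append, Language.leftQuotient_append]
    rcases leftQuotient_quasiLanguage_singleton hβ j n d with h | ⟨j', n', h⟩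
    · left
      rw [h]
      rfl
    · rw [h]
      exact ih j' n'

/-- Reading the quasi-lazy word itself follows the orbit of `1`, so every language along it really
occurs as a quotient. -/
theorem exists_leftQuotient_eq_quasiLanguage (hβ : ∀ n, 1 < β n) (j n : ℕ) :
    ∃ w, (prefixLanguage β j 1).leftQuotient w = quasiLanguage β j n := by
  induction n with
  | zero => exact ⟨[], rfl⟩
  | succ n ih =>
    obtain ⟨w, hw⟩ := ih
    have hr : orbit (quasiNext β) n j 1 ∈ Set.Ioc (0 : ℝ) 1 := quasiOrbit_mem hβ n j (by simp)
    refine ⟨w ++ [⟨maxDigit β (j + n) - quasiDigit β (j + n) (orbit (quasiNext β) n j 1), j + n,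
      Nat.sub_le _ _⟩], ?_⟩
    rw [Language.leftQuotient_append, hw, quasiLanguage,
      leftQuotient_singleton_quasiDigit hβ _ hr _ rfl, quasiLanguage, orbit_succ, add_assoc]

theorem exists_isLazyPrefix (i : ℕ) (y : ℝ) (n : ℕ) :
    ∃ w : List (Alphabet β), w.length = n ∧ IsLazyPrefix β w i y :=
  ⟨List.ofFn fun k : Fin n => ⟨lazyWord β i y k, i + k, Nat.sub_le _ _⟩, by simp,
    (isLazyPrefix_iff_forall _ _ _).2 fun k hk => by simp⟩

/-- If `s < t < r`, a long enough prefix of the word of `t` is shared by no point below `s`. -/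
theorem prefixLanguage_injOn {b : ℝ} (hb : 1 < b) (hβ : ∀ n, b ≤ β n) (i : ℕ) :
    Set.InjOn (prefixLanguage β i) (Set.Ioc 0 1) := by
  have key : ∀ r ∈ Set.Ioc (0 : ℝ) 1, ∀ s ∈ Set.Ioc (0 : ℝ) 1,
      prefixLanguage β i r = prefixLanguage β i s → r ≤ s := by
    intro r hr s hs h
    by_contra! hlt
    obtain ⟨t, hst, htr⟩ := exists_between hlt
    have ht : t ∈ Set.Ico (0 : ℝ) 1 := ⟨(hs.1.trans hst).le, htr.trans_le hr.2⟩
    obtain ⟨n, hn⟩ := pow_unbounded_of_one_lt (1 / (t - s)) hb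
    obtain ⟨w, hw, hwt⟩ := exists_isLazyPrefix (β := β) i t n
    have hmem : w ∈ prefixLanguage β i s := h ▸ ⟨t, ht, htr, hwt⟩
    obtain ⟨y, hy, hys, hwy⟩ := hmem
    have h1 := IsLazyPrefix.abs_sub_mul_pow_lt hb hβ ht hy hwt hwy
    rw [abs_of_pos (by linarith), hw] at h1
    rw [div_lt_iff₀ (by linarith)] at hn
    have : (0 : ℝ) < b ^ n := by positivity
    nlinarith
  exact fun r hr s hs h => le_antisymm (key r hr s hs h) (key s hs r hr h.symm)

/-- The prefixes of the complements of all greedy expansions in the bases `β^(i)`. -/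
def totalLanguage (β : ℕ → ℝ) : Language (Alphabet β) :=
  {w | ∃ i, w ∈ prefixLanguage β i 1}

theorem mem_totalLanguage_iff_lt {p : ℕ} (hp1 : 1 ≤ p) (hp : ∀ n, β (n + p) = β n)
    {w : List (Alphabet β)} :
    w ∈ totalLanguage β ↔ ∃ i < p, w ∈ prefixLanguage β i 1 := by
  constructor
  · rintro ⟨i, h⟩
    rw [eq_mod_of_periodic (prefixLanguage_add_period hp) i] at h
    exact ⟨_, Nat.mod_lt _ hp1, h⟩
  · rintro ⟨i, -, h⟩
    exact ⟨i, h⟩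

theorem append_mem_prefixLanguage_right (hβ : ∀ n, 1 < β n) {u v : List (Alphabet β)} {i : ℕ}
    (h : u ++ v ∈ prefixLanguage β i 1) : v ∈ prefixLanguage β (i + u.length) 1 := by
  obtain ⟨y, hy, -, h⟩ := h
  have := greedyOrbit_mem hβ u.length i hy
  exact ⟨_, this, this.2, ((isLazyPrefix_append _ _ _ _).1 h).2⟩

theorem append_mem_prefixLanguage_left {u v : List (Alphabet β)} {i : ℕ} {r : ℝ}
    (h : u ++ v ∈ prefixLanguage β i r) : u ∈ prefixLanguage β i r := by
  obtain ⟨y, hy, hr, h⟩ := h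
  exact ⟨y, hy, hr, ((isLazyPrefix_append _ _ _ _).1 h).1⟩

end Prefixes

/-! ### Auxiliary facts on periodicity and regular languages. -/

theorem IsUltimatelyPeriodic.finite_range {α : Type*} {a : ℕ → α} (h : IsUltimatelyPeriodic a) :
    (Set.range a).Finite := by
  obtain ⟨m, n, hn, h⟩ := h
  refine ((Set.finite_Iio (m + n)).image a).subset ?_
  rintro _ ⟨k, rfl⟩
  induction k using Nat.strong_induction_on with
  | _ k ih =>
    rcases lt_or_ge k (m + n) with hk | hk
    · exact ⟨k, hk, rfl⟩
    · have := h (k - n) (by omega)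
      rw [Nat.sub_add_cancel (by omega)] at this
      rw [this]
      exact ih _ (by omega)

theorem isRegular_zero {α : Type*} : (0 : Language α).IsRegular :=
  .of_finite_range_leftQuotient <| (Set.finite_singleton 0).subset <| by rintro _ ⟨w, rfl⟩; rfl

/-- The union of the languages `F i` over `i < n`. -/
def unionLT {α : Type*} (F : ℕ → Language α) (n : ℕ) : Language α := {w | ∃ i < n, w ∈ F i}

theorem isRegular_unionLT {α : Type*} {F : ℕ → Language α} (hF : ∀ i, (F i).IsRegular) (n : ℕ) :
    (unionLT F n).IsRegular := by
  induction n with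
  | zero =>
    have e : unionLT F 0 = 0 := by
      ext w
      change (∃ i < 0, w ∈ F i) ↔ _
      simp [Language.notMem_zero]
    rw [e]
    exact isRegular_zero
  | succ n ih =>
    have e : unionLT F (n + 1) = unionLT F n + F n := by
      ext w
      rw [Language.mem_add]
      change (∃ i < n + 1, w ∈ F i) ↔ (∃ i < n, w ∈ F i) ∨ w ∈ F n
      constructor
      · rintro ⟨i, hi, h⟩
        rcases Nat.lt_succ_iff_lt_or_eq.1 hi with hi | rfl
        exacts [.inl ⟨i, hi, h⟩, .inr h]
      · rintro (⟨i, hi, h⟩ | h)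
        exacts [⟨i, by omega, h⟩, ⟨n, by omega, h⟩]
    rw [e]
    exact ih.add (hF n)

theorem add_mul_period {α : Type*} {p : ℕ} {f : ℕ → α} (hf : ∀ i, f (i + p) = f i) (n i : ℕ) :
    f (i + n * p) = f i := by
  have := (Function.Periodic.nat_mul (f := f) (c := p) hf n) i
  simpa using this

/-! ### Ultimate periodicity and finiteness of the set of quotients. -/

variable {β : ℕ → ℝ} {p : ℕ}

/-- With equal digits and equal bases, the difference of the two orbit points grows at least like `b
^ l`, but it is bounded by `1`; hence it vanishes. -/
theorem quasiOrbit_eq_of_quasiLazyWord_eq {b : ℝ} (hb : 1 < b) (hβ : ∀ n, b ≤ β n) {i m N : ℕ}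
    (hN : ∀ n, β (n + N) = β n)
    (h : ∀ k, m ≤ k → quasiLazyWord β i 1 (k + N) = quasiLazyWord β i 1 k) {k : ℕ} (hk : m ≤ k) :
    orbit (quasiNext β) (k + N) i 1 = orbit (quasiNext β) k i 1 := by
  have hβ1 : ∀ n, 1 < β n := fun n => hb.trans_le (hβ n)
  have hmem : ∀ k, orbit (quasiNext β) k i 1 ∈ Set.Ioc (0 : ℝ) 1 :=
    fun k => quasiOrbit_mem hβ1 k i (by simp)
  have step : ∀ k, m ≤ k →
      orbit (quasiNext β) (k + 1 + N) i 1 - orbit (quasiNext β) (k + 1) i 1 =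
        β (i + k) * (orbit (quasiNext β) (k + N) i 1 - orbit (quasiNext β) k i 1) := by
    intro k hk
    have h1 := h k hk
    have h2 := quasiDigit_le_maxDigit hβ1 (i + k) (hmem k)
    have h3 := quasiDigit_le_maxDigit hβ1 (i + (k + N)) (hmem (k + N))
    unfold quasiLazyWord at h1
    rw [← add_assoc, maxDigit_add_period hN] at h1 h3
    have h4 : quasiDigit β (i + k + N) (orbit (quasiNext β) (k + N) i 1) =
        quasiDigit β (i + k) (orbit (quasiNext β) k i 1) := by omega
    rw [show k + 1 + N = k + N + 1 by ring, orbit_succ, orbit_succ, quasiNext, quasiNext,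
      ← add_assoc, h4, hN]
    ring
  have grow : ∀ l,
      |orbit (quasiNext β) (k + N) i 1 - orbit (quasiNext β) k i 1| * b ^ l ≤
        |orbit (quasiNext β) (k + l + N) i 1 - orbit (quasiNext β) (k + l) i 1| := by
    intro l
    induction l with
    | zero => simp
    | succ l ih =>
      rw [← add_assoc, step _ (by omega), abs_mul, abs_of_pos (zero_lt_one.trans (hβ1 (i + (k + l)))),
        pow_succ]
      have := hβ (i + (k + l))
      have h0 := abs_nonneg (orbit (quasiNext β) (k + l + N) i 1 - orbit (quasiNext β) (k + l) i 1)
      nlinarith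
  by_contra hne
  have hpos := abs_pos.2 (sub_ne_zero.2 hne)
  obtain ⟨l, hl⟩ := pow_unbounded_of_one_lt
    (1 / |orbit (quasiNext β) (k + N) i 1 - orbit (quasiNext β) k i 1|) hb
  rw [div_lt_iff₀ hpos] at hl
  have h1 := grow l
  have h2 : |orbit (quasiNext β) (k + l + N) i 1 - orbit (quasiNext β) (k + l) i 1| ≤ 1 := by
    have ha := hmem (k + l + N)
    have hc := hmem (k + l)
    rw [abs_le]
    constructor <;> linarith [ha.1, ha.2, hc.1, hc.2]
  linarith

theorem finite_range_quasiLanguage_iff (hβ : ∀ n, 1 < β n) (hp1 : 1 ≤ p)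
    (hp : ∀ n, β (n + p) = β n) (i : ℕ) :
    (Set.range (quasiLanguage β i)).Finite ↔ IsUltimatelyPeriodic (quasiLazyWord β i 1) := by
  obtain ⟨b, hb, hbβ⟩ := exists_one_lt_forall_le hβ hp1 hp
  have hmem : ∀ k, orbit (quasiNext β) k i 1 ∈ Set.Ioc (0 : ℝ) 1 :=
    fun k => quasiOrbit_mem hβ k i (by simp)
  constructor
  · intro hfin
    -- Recording `n % p` makes a coincidence compare thresholds in one and the same phase, where
    -- injectivity applies.
    have hfin' : (Set.range fun n => (quasiLanguage β i n, n % p)).Finite := by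
      refine (hfin.prod (Set.finite_Iio p)).subset ?_
      rintro _ ⟨n, rfl⟩
      exact ⟨⟨n, rfl⟩, Nat.mod_lt _ hp1⟩
    obtain ⟨m, -, n, -, hne, heq⟩ := Set.infinite_univ.exists_ne_map_eq_of_mapsTo
      (f := fun n => (quasiLanguage β i n, n % p)) (fun n _ => Set.mem_range_self n) hfin'
    wlog hlt : m < n generalizing m n
    · exact this n m hne.symm heq.symm (by omega)
    obtain ⟨hL, hmod⟩ := Prod.mk.inj heq
    obtain ⟨c, hc⟩ := (Nat.modEq_iff_dvd' hlt.le).1 hmod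
    have hcp : ∀ {α : Type} {f : ℕ → α}, (∀ i, f (i + p) = f i) → ∀ i, f (i + (n - m)) = f i :=
      fun hf i => by rw [hc, mul_comm]; exact add_mul_period hf c i
    have hr : orbit (quasiNext β) n i 1 = orbit (quasiNext β) m i 1 := by
      refine prefixLanguage_injOn hb hbβ (i + m) (hmem n) (hmem m) ?_
      have e : prefixLanguage β (i + n) = prefixLanguage β (i + m) := by
        rw [show i + n = i + m + (n - m) by omega]
        exact hcp (prefixLanguage_add_period hp) _
      exact (congrFun e _).symm.trans hL.symm
    have horb : ∀ l, orbit (quasiNext β) (m + l + (n - m)) i 1 =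
        orbit (quasiNext β) (m + l) i 1 := by
      intro l
      induction l with
      | zero => rw [add_zero, show m + (n - m) = n by omega, hr]
      | succ l ih =>
        rw [show m + (l + 1) + (n - m) = m + l + (n - m) + 1 by ring, orbit_succ, ih,
          ← add_assoc m l 1, orbit_succ, ← add_assoc i (m + l), hcp (quasiNext_add_period hp)]
    refine ⟨m, n - m, by omega, fun k hk => ?_⟩
    obtain ⟨l, rfl⟩ := Nat.exists_eq_add_of_le hk
    unfold quasiLazyWord quasiDigit
    rw [horb, ← add_assoc i, hcp (maxDigit_add_period hp), hcp hp]
  · rintro ⟨m, n, hn, h⟩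
    have h' : ∀ c k, m ≤ k → quasiLazyWord β i 1 (k + c * n) = quasiLazyWord β i 1 k := by
      intro c k hk
      induction c with
      | zero => simp
      | succ c ih => rw [show k + (c + 1) * n = k + c * n + n by ring, h _ (by omega), ih]
    -- `n * p` is a period of both the base and the tail of the word.
    refine IsUltimatelyPeriodic.finite_range ⟨m, n * p, Nat.mul_pos hn hp1, fun k hk => ?_⟩
    unfold quasiLanguage
    rw [quasiOrbit_eq_of_quasiLazyWord_eq hb hbβ (add_mul_period hp n)
      (fun k hk => by rw [mul_comm]; exact h' p k hk) hk, ← add_assoc,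
      add_mul_period (prefixLanguage_add_period hp)]

theorem finite_quasiLanguages (hp1 : 1 ≤ p) (hp : ∀ n, β (n + p) = β n)
    (h : ∀ i < p, (Set.range (quasiLanguage β i)).Finite) :
    {X | ∃ j n, X = quasiLanguage β j n}.Finite := by
  refine ((Set.finite_Iio p).biUnion h).subset ?_
  rintro _ ⟨j, n, rfl⟩
  have hj : ∀ j, quasiLanguage β (j + p) = quasiLanguage β j := fun j => by
    funext n
    unfold quasiLanguage
    rw [orbit_add_period (quasiNext_add_period hp), show j + p + n = j + n + p by ring,
      prefixLanguage_add_period hp]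
  rw [eq_mod_of_periodic hj j]
  exact Set.mem_biUnion (Nat.mod_lt j hp1) ⟨n, rfl⟩

theorem isRegular_totalLanguage (hβ : ∀ n, 1 < β n) (hp1 : 1 ≤ p) (hp : ∀ n, β (n + p) = β n)
    (h : ∀ i < p, (Set.range (quasiLanguage β i)).Finite) : (totalLanguage β).IsRegular := by
  have hF : ∀ i, (prefixLanguage β i 1).IsRegular := fun i => by
    refine .of_finite_range_leftQuotient (((finite_quasiLanguages hp1 hp h).insert 0).subset ?_)
    rintro _ ⟨w, rfl⟩
    exact leftQuotient_quasiLanguage hβ w i 0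
  have e : totalLanguage β = unionLT (fun i => prefixLanguage β i 1) p := by
    ext w
    exact mem_totalLanguage_iff_lt hp1 hp
  rw [e]
  exact isRegular_unionLT hF p

/-! ### Isolating one phase of the union. -/

/-- The word of largest digits, complementary to a word of zeros. -/
noncomputable def maxWord (β : ℕ → ℝ) : ℕ → ℕ → List (Alphabet β)
  | 0, _ => []
  | K + 1, i => ⟨maxDigit β i, i, le_rfl⟩ :: maxWord β K (i + 1)

theorem length_maxWord (K i : ℕ) : (maxWord β K i).length = K := by
  induction K generalizing i with
  | zero => rfl
  | succ K ih => simp [maxWord, ih]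

theorem exists_isLazyPrefix_maxWord {b : ℝ} (hb : 1 < b) (hβ : ∀ n, b ≤ β n) (K i : ℕ) {s : ℝ}
    (hs : s ∈ Set.Ico (0 : ℝ) 1) :
    ∃ t, 0 ≤ t ∧ t * b ^ K ≤ s ∧ IsLazyPrefix β (maxWord β K i) i t ∧
      orbit (greedyNext β) K i t = s := by
  have hβ1 : ∀ n, 1 < β n := fun n => hb.trans_le (hβ n)
  induction K generalizing i with
  | zero => exact ⟨s, hs.1, by simp, trivial, rfl⟩
  | succ K ih =>
    obtain ⟨t, ht0, hts, hw, ho⟩ := ih (i + 1)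
    have hi := hβ i
    have hi1 := hβ1 i
    have ht : t ∈ Set.Ico (0 : ℝ) 1 := by
      have : 1 ≤ b ^ K := one_le_pow₀ hb.le
      exact ⟨ht0, by nlinarith [hs.2]⟩
    have e1 := greedyDigit_div hβ1 i 0 ht
    have e2 := greedyNext_div hβ1 i 0 ht
    rw [Nat.cast_zero, zero_add] at e1 e2
    refine ⟨t / β i, div_nonneg ht0 (by linarith), ?_, ⟨by simp [e1], by rwa [e2]⟩, ?_⟩
    · refine le_trans ?_ hts
      rw [div_mul_eq_mul_div, div_le_iff₀ (by linarith), pow_succ]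
      have : 0 ≤ t * b ^ K := by positivity
      nlinarith
    · rw [orbit, e2, ho]

/-- A lazy prefix is realised by a point with any prescribed sufficiently small orbit end. -/
theorem IsLazyPrefix.exists_forall_lt (hβ : ∀ n, 1 < β n) {w : List (Alphabet β)} {i : ℕ} {y : ℝ}
    (hy : y ∈ Set.Ico (0 : ℝ) 1) (h : IsLazyPrefix β w i y) :
    ∃ ε > 0, ∃ a, 0 ≤ a ∧ a ≤ y ∧ ∀ t, 0 ≤ t → t < ε → ∃ z ∈ Set.Ico (0 : ℝ) 1, z ≤ a + t ∧
      IsLazyPrefix β w i z ∧ orbit (greedyNext β) w.length i z = t := by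
  induction w generalizing i y with
  | nil =>
    exact ⟨1, one_pos, 0, le_rfl, hy.1, fun t h0 h1 => ⟨t, ⟨h0, h1⟩, by simp, trivial, rfl⟩⟩
  | cons d w ih =>
    obtain ⟨ε, hε, a, ha0, hay, H⟩ := ih (greedyNext_mem hβ i hy) h.2
    have hi := hβ i
    have hi0 : 0 < β i := by linarith
    set c := greedyDigit β i y with hc
    have hle : (c + a) / β i ≤ y := by
      rw [eq_digit_add_greedyNext_div hβ i y]
      gcongr
    -- The second bound keeps the constructed point below `1`.
    refine ⟨min ε (1 - (c + a) / β i), lt_min hε (by linarith [hy.2]), (c + a) / β i,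
      div_nonneg (by positivity) hi0.le, hle, fun t ht0 ht => ?_⟩
    obtain ⟨z, hz, hza, hw, ho⟩ := H t ht0 (ht.trans_le (min_le_left _ _))
    have hz' : (c + z) / β i ≤ (c + a) / β i + t := by
      rw [div_add' _ _ _ hi0.ne']
      refine div_le_div_of_nonneg_right ?_ hi0.le
      nlinarith
    refine ⟨(c + z) / β i, ⟨div_nonneg (add_nonneg (Nat.cast_nonneg _) hz.1) hi0.le, ?_⟩, hz',
      ⟨?_, ?_⟩, ?_⟩
    · linarith [ht.trans_le (min_le_right _ _)]
    · rw [greedyDigit_div hβ i c hz]; exact h.1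
    · rwa [greedyNext_div hβ i c hz]
    · rw [List.length_cons, orbit, greedyNext_div hβ i c hz, ho]

/-- A long block of greedy zeros shrinks the point needed for `v` below the room left by `w`, so `w`
no longer constrains what follows. -/
theorem exists_forall_append_maxWord_mem {b : ℝ} (hb : 1 < b) (hβ : ∀ n, b ≤ β n)
    {w : List (Alphabet β)} {i : ℕ} (h : w ∈ prefixLanguage β i 1) :
    ∃ K₀, ∀ K ≥ K₀, ∀ v ∈ prefixLanguage β (i + w.length + K) 1,
      w ++ maxWord β K (i + w.length) ++ v ∈ prefixLanguage β i 1 := by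
  have hβ1 : ∀ n, 1 < β n := fun n => hb.trans_le (hβ n)
  obtain ⟨y, hy, -, hw⟩ := h
  obtain ⟨ε, hε, a, -, -, H⟩ := hw.exists_forall_lt hβ1 hy
  obtain ⟨K₀, hK₀⟩ := pow_unbounded_of_one_lt (1 / ε) hb
  refine ⟨K₀, fun K hK v hv => ?_⟩
  obtain ⟨s, hs, -, hv⟩ := hv
  obtain ⟨t, ht0, hts, hz, ho⟩ := exists_isLazyPrefix_maxWord hb hβ K (i + w.length) hs
  have ht : t < ε := by
    have h1 : b ^ K₀ ≤ b ^ K := pow_le_pow_right₀ hb.le hK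
    have h2 : 1 < b ^ K * ε := by
      rw [div_lt_iff₀ hε] at hK₀
      nlinarith
    have h3 : (0 : ℝ) < b ^ K := by positivity
    by_contra! h4
    nlinarith [hs.2]
  obtain ⟨z, hz1, -, hwz, hoz⟩ := H t ht0 ht
  refine ⟨z, hz1, hz1.2, ?_⟩
  rw [List.append_assoc, isLazyPrefix_append, isLazyPrefix_append, hoz, length_maxWord, ho]
  exact ⟨hwz, hz, hv⟩

theorem exists_leftQuotient_totalLanguage_eq (hβ : ∀ n, 1 < β n) (hp1 : 1 ≤ p)
    (hp : ∀ n, β (n + p) = β n) (j : ℕ) :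
    ∃ w, (totalLanguage β).leftQuotient w = prefixLanguage β j 1 := by
  classical
  obtain ⟨b, hb, hbβ⟩ := exists_one_lt_forall_le hβ hp1 hp
  let Ph : List (Alphabet β) → Finset ℕ :=
    fun w => (Finset.range p).filter fun i => w ∈ prefixLanguage β i 1
  have hPh : ∀ w i, i ∈ Ph w ↔ i < p ∧ w ∈ prefixLanguage β i 1 := fun w i => by simp [Ph]
  -- Take `w` with the fewest, but at least one, admissible phases: every extension of `w` in the
  -- total language then keeps all of them, in particular `i`.
  have hne : ∃ n w, (Ph w).Nonempty ∧ (Ph w).card = n :=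
    ⟨_, [], ⟨0, (hPh _ _).2 ⟨hp1, 0, by simp, by simp, trivial⟩⟩, rfl⟩
  obtain ⟨w, ⟨i, hi⟩, hcard⟩ := Nat.find_spec hne
  have hmin : ∀ u, (Ph (w ++ u)).Nonempty → i ∈ Ph (w ++ u) := by
    intro u hu
    have hsub : Ph (w ++ u) ⊆ Ph w := fun k hk => by
      rw [hPh] at hk ⊢
      exact ⟨hk.1, append_mem_prefixLanguage_left hk.2⟩
    have hle : (Ph w).card ≤ (Ph (w ++ u)).card := by
      rw [hcard]
      exact Nat.find_min' hne ⟨_, hu, rfl⟩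
    rwa [Finset.eq_of_subset_of_card_le hsub hle]
  obtain ⟨K₀, hK₀⟩ := exists_forall_append_maxWord_mem hb hbβ ((hPh _ _).1 hi).2
  obtain ⟨K, hK, c, hc⟩ : ∃ K ≥ K₀, ∃ c, i + w.length + K = j + c * p := by
    -- `K` is at least `K₀` and brings the time after the block to `j` modulo `p`; the natural
    -- subtraction is exact because `1 ≤ p`.
    refine ⟨j + (i + w.length + K₀) * p - (i + w.length), ?_, i + w.length + K₀, ?_⟩ <;>
    · have := Nat.le_mul_of_pos_right (i + w.length + K₀) hp1
      omega
  have hphase : prefixLanguage β (i + w.length + K) = prefixLanguage β j := by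
    rw [hc, add_mul_period (prefixLanguage_add_period hp)]
  refine ⟨w ++ maxWord β K (i + w.length), ?_⟩
  ext v
  rw [Language.mem_leftQuotient]
  constructor
  · intro h
    obtain ⟨k, hk, h⟩ := (mem_totalLanguage_iff_lt hp1 hp).1 h
    have h1 := hmin (maxWord β K (i + w.length) ++ v) ⟨k, (hPh _ _).2 ⟨hk, by rwa [← List.append_assoc]⟩⟩
    rw [hPh, ← List.append_assoc] at h1
    have h2 := append_mem_prefixLanguage_right hβ h1.2
    rwa [List.length_append, length_maxWord, ← add_assoc, hphase] at h2
  · intro h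
    exact ⟨i, hK₀ K hK v (by rwa [hphase])⟩

theorem finite_range_quasiLanguage_of_isRegular (hβ : ∀ n, 1 < β n) (hp1 : 1 ≤ p)
    (hp : ∀ n, β (n + p) = β n) (h : (totalLanguage β).IsRegular) (j : ℕ) :
    (Set.range (quasiLanguage β j)).Finite := by
  refine h.finite_range_leftQuotient.subset ?_
  rintro _ ⟨n, rfl⟩
  obtain ⟨u, hu⟩ := exists_leftQuotient_totalLanguage_eq hβ hp1 hp j
  obtain ⟨v, hv⟩ := exists_leftQuotient_eq_quasiLanguage hβ j n
  exact ⟨u ++ v, by rw [Language.leftQuotient_append, hu, hv]⟩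

theorem isRegular_totalLanguage_iff (hβ : ∀ n, 1 < β n) (hp1 : 1 ≤ p)
    (hp : ∀ n, β (n + p) = β n) :
    (totalLanguage β).IsRegular ↔ ∀ i < p, IsUltimatelyPeriodic (quasiLazyWord β i 1) := by
  simp only [← finite_range_quasiLanguage_iff hβ hp1 hp]
  exact ⟨fun h j _ => finite_range_quasiLanguage_of_isRegular hβ hp1 hp h j,
    isRegular_totalLanguage hβ hp1 hp⟩

/-! ### From lazy expansions to greedy ones, and the factors of the shift. -/

section Expansions

variable {β : ℕ → ℝ} {p : ℕ}

theorem pow_le_denom {b : ℝ} (hb : 1 < b) (hβ : ∀ n, b ≤ β n) (n : ℕ) :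
    b ^ (n + 1) ≤ denom β n := by
  have h := Finset.prod_le_prod (s := Finset.range (n + 1)) (f := fun _ => b) (g := β)
    (fun _ _ => by linarith) (fun k _ => hβ k)
  simpa [denom] using h

theorem denom_pos (hβ : ∀ n, 1 < β n) (n : ℕ) : 0 < denom β n :=
  Finset.prod_pos fun k _ => by linarith [hβ k]

theorem summable_maxDigit_div_denom {b : ℝ} (hb : 1 < b) (hβ : ∀ n, b ≤ β n) {M : ℕ}
    (hM : ∀ n, maxDigit β n ≤ M) : Summable fun n => (maxDigit β n : ℝ) / denom β n := by
  have hgeom : Summable fun n : ℕ => (M : ℝ) * b⁻¹ ^ n :=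
    (summable_geometric_of_lt_one (by positivity) (inv_lt_one_of_one_lt₀ hb)).mul_left _
  refine hgeom.of_nonneg_of_le (fun n => ?_) fun n => ?_
  · exact div_nonneg (Nat.cast_nonneg _) (denom_pos (fun n => hb.trans_le (hβ n)) n).le
  · rw [inv_pow, ← div_eq_mul_inv]
    have h1 : b ^ n ≤ denom β n :=
      (pow_le_pow_right₀ hb.le n.le_succ).trans (pow_le_denom hb hβ n)
    have h2 : (maxDigit β n : ℝ) ≤ M := Nat.cast_le.2 (hM n)
    gcongr

theorem xMax_eq_sum_add_xTail (hs : Summable fun n => (maxDigit β n : ℝ) / denom β n) (N : ℕ) :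
    xMax β = ∑ n ∈ Finset.range N, (maxDigit β n : ℝ) / denom β n +
      (maxDigit β N : ℝ) / denom β N + xTail β N := by
  rw [xMax, ← hs.sum_add_tsum_nat_add (N + 1), Finset.sum_range_succ, xTail]
  simp only [add_comm]

theorem sInf_le_and_le_add {m : ℕ} {s : ℝ} (hs : 0 ≤ s) (hm : ⌊s⌋₊ ≤ m) :
    sInf {d : ℕ | d ≤ m ∧ (m : ℝ) ≤ d + s} = m - ⌊s⌋₊ := by
  refine IsLeast.csInf_eq ⟨⟨Nat.sub_le _ _, ?_⟩, ?_⟩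
  · rw [Nat.cast_sub hm]
    linarith [Nat.floor_le hs]
  · rintro d ⟨hd, h⟩
    have : m - d ≤ ⌊s⌋₊ := by
      rw [Nat.le_floor_iff hs, Nat.cast_sub hd]
      linarith
    omega

/-- Here `β N * t / denom β N` is the greedy remainder before step `N`, since `denom β N` already
contains `β N`. The condition on `d` becomes `maxDigit β N ≤ d + β N * t`, so the least `d` is
complementary to the largest integer below `β N * t`, inclusively. -/
theorem lazyStep_eq (hβ : ∀ n, 1 < β n)
    (hs : Summable fun n => (maxDigit β n : ℝ) / denom β n) (N : ℕ) {y t : ℝ}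
    (ht : t ∈ Set.Ico (0 : ℝ) 1) :
    lazyStep β (xMax β - y) N
      (∑ n ∈ Finset.range N, (maxDigit β n : ℝ) / denom β n - y + β N * t / denom β N) =
        maxDigit β N - greedyDigit β N t := by
  have h0 : 0 ≤ β N * t := mul_nonneg (by linarith [hβ N]) ht.1
  rw [greedyDigit, ← sInf_le_and_le_add h0 (greedyDigit_le_maxDigit hβ N ht), lazyStep]
  congr 1
  ext d
  have hd := denom_pos hβ N
  simp only [Set.mem_ofPred_eq, and_congr_right_iff, ge_iff_le]
  intro _
  rw [xMax_eq_sum_add_xTail hs N, ← div_le_div_iff_of_pos_right (a := (maxDigit β N : ℝ)) hd, add_div]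
  constructor <;> intro h <;> linarith

/-- The invariant of the complementation: the first `N` lazy and greedy contributions add up to the
sum of the largest ones, the greedy part being `y` minus its remainder. -/
theorem lazyPartialSum_sub (hβ : ∀ n, 1 < β n)
    (hs : Summable fun n => (maxDigit β n : ℝ) / denom β n) {y : ℝ}
    (hy : y ∈ Set.Ico (0 : ℝ) 1) (N : ℕ) :
    lazyPartialSum β (xMax β - y) N = ∑ n ∈ Finset.range N, (maxDigit β n : ℝ) / denom β n - y +
      β N * orbit (greedyNext β) N 0 y / denom β N := by
  induction N with
  | zero =>
    have := hβ 0
    simp only [lazyPartialSum, denom, Finset.range_zero, Finset.sum_empty, orbit, zero_add,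
      Finset.prod_range_one]
    field_simp
    ring
  | succ N ih =>
    have hmem := greedyOrbit_mem hβ N 0 hy
    rw [lazyPartialSum, ih, lazyStep_eq hβ hs N hmem,
      Nat.cast_sub (greedyDigit_le_maxDigit hβ N hmem), Finset.sum_range_succ, orbit_succ, zero_add,
      greedyNext]
    have hd := denom_pos hβ N
    have h1 := hβ (N + 1)
    have e : denom β (N + 1) = denom β N * β (N + 1) := by
      rw [denom, Finset.prod_range_succ, denom]
    rw [e]
    field_simp
    ring

theorem lazyExpansion_sub (hβ : ∀ n, 1 < β n)
    (hs : Summable fun n => (maxDigit β n : ℝ) / denom β n) {y : ℝ}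
    (hy : y ∈ Set.Ico (0 : ℝ) 1) : lazyExpansion β (xMax β - y) = lazyWord β 0 y := by
  funext N
  rw [lazyExpansion, lazyPartialSum_sub hβ hs hy, lazyStep_eq hβ hs N (greedyOrbit_mem hβ N 0 hy),
    lazyWord, zero_add]

theorem orbit_greedyNext_shiftBase (n i j : ℕ) (y : ℝ) :
    orbit (greedyNext (shiftBase β i)) n j y = orbit (greedyNext β) n (i + j) y := by
  induction n generalizing j y with
  | zero => rfl
  | succ n ih => rw [orbit, orbit, ih]; rfl

theorem lazyWord_shiftBase (i : ℕ) (y : ℝ) :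
    lazyWord (shiftBase β i) 0 y = lazyWord β i y := by
  funext k
  rw [lazyWord, lazyWord, orbit_greedyNext_shiftBase, zero_add]
  rfl

theorem lazyExpansion_shiftBase_sub (hβ : ∀ n, 1 < β n) (hp1 : 1 ≤ p) (hp : ∀ n, β (n + p) = β n)
    (i : ℕ) {y : ℝ} (hy : y ∈ Set.Ico (0 : ℝ) 1) :
    lazyExpansion (shiftBase β i) (xMax (shiftBase β i) - y) = lazyWord β i y := by
  obtain ⟨b, hb, hbβ⟩ := exists_one_lt_forall_le hβ hp1 hp
  obtain ⟨M, hM⟩ := exists_maxDigit_le hp1 hp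
  rw [← lazyWord_shiftBase]
  exact lazyExpansion_sub (fun n => hβ (i + n))
    (summable_maxDigit_div_denom hb (fun n => hbβ (i + n)) fun n => hM (i + n)) hy

theorem lazyExpansions_shiftBase (hβ : ∀ n, 1 < β n) (hp1 : 1 ≤ p) (hp : ∀ n, β (n + p) = β n)
    (i : ℕ) : lazyExpansions (shiftBase β i) = lazyWord β i '' Set.Ico 0 1 := by
  ext a
  constructor
  · rintro ⟨x, hx, rfl⟩
    have hy : xMax (shiftBase β i) - x ∈ Set.Ico (0 : ℝ) 1 :=
      ⟨by linarith [hx.2], by linarith [hx.1]⟩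
    refine ⟨_, hy, ?_⟩
    rw [← lazyExpansion_shiftBase_sub hβ hp1 hp i hy, sub_sub_cancel]
  · rintro ⟨y, hy, rfl⟩
    exact ⟨xMax (shiftBase β i) - y, ⟨by linarith [hy.2], by linarith [hy.1]⟩,
      lazyExpansion_shiftBase_sub hβ hp1 hp i hy⟩

/-- The left limit of the floor is the ceiling minus one; this is how quasi-greedy digits arise. -/
theorem eventually_floor_sub_mul {s c : ℝ} (hs : 0 < s) (hc : 0 < c) :
    ∀ᶠ h in 𝓝[>] (0 : ℝ), ⌊s - c * h⌋₊ = ⌈s⌉₊ - 1 := by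
  have h1 : 1 ≤ ⌈s⌉₊ := Nat.one_le_iff_ne_zero.2 (Nat.ceil_pos.2 hs).ne'
  have hcast : ((⌈s⌉₊ - 1 : ℕ) : ℝ) = ⌈s⌉₊ - 1 := by rw [Nat.cast_sub h1, Nat.cast_one]
  have h2 := Nat.le_ceil s
  have h3 := Nat.ceil_lt_add_one hs.le
  have hδ : 0 < (s - (⌈s⌉₊ - 1 : ℕ)) / c := div_pos (by linarith) hc
  filter_upwards [Ioo_mem_nhdsGT hδ] with h hh
  have h4 := (lt_div_iff₀ hc).1 hh.2
  have h5 := mul_pos hc hh.1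
  have h6 : (0 : ℝ) ≤ ((⌈s⌉₊ - 1 : ℕ) : ℝ) := Nat.cast_nonneg _
  rw [Nat.floor_eq_iff (by linarith)]
  constructor <;> linarith

/-- The constant `c` is the product of the bases passed: for small `h` no digit changes, so the
perturbation is only scaled. -/
theorem eventually_greedyOrbit_sub (hβ : ∀ n, 1 < β n) (i : ℕ) {r : ℝ}
    (hr : r ∈ Set.Ioc (0 : ℝ) 1) (n : ℕ) :
    ∃ c > 0, ∀ᶠ h in 𝓝[>] (0 : ℝ),
      orbit (greedyNext β) n i (r - h) = orbit (quasiNext β) n i r - c * h := by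
  induction n with
  | zero => exact ⟨1, one_pos, .of_forall fun h => by rw [orbit, orbit, one_mul]⟩
  | succ n ih =>
    obtain ⟨c, hc, H⟩ := ih
    have hb : 0 < β (i + n) := by linarith [hβ (i + n)]
    have hbc : 0 < β (i + n) * c := mul_pos hb hc
    have hq := (quasiOrbit_mem hβ n i hr).1
    refine ⟨β (i + n) * c, hbc, ?_⟩
    filter_upwards [H, eventually_floor_sub_mul (mul_pos hb hq) hbc] with h h1 h2
    rw [orbit_succ, orbit_succ, h1, greedyNext, greedyDigit, quasiNext, quasiDigit, ← h2, mul_sub,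
      ← mul_assoc]
    ring

theorem eventually_lazyWord_sub (hβ : ∀ n, 1 < β n) (i : ℕ) {r : ℝ}
    (hr : r ∈ Set.Ioc (0 : ℝ) 1) (n : ℕ) :
    ∀ᶠ h in 𝓝[>] (0 : ℝ), lazyWord β i (r - h) n = quasiLazyWord β i r n := by
  obtain ⟨c, hc, H⟩ := eventually_greedyOrbit_sub hβ i hr n
  have hb : 0 < β (i + n) := by linarith [hβ (i + n)]
  filter_upwards [H, eventually_floor_sub_mul (mul_pos hb (quasiOrbit_mem hβ n i hr).1)
    (mul_pos hb hc)] with h h1 h2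
  rw [lazyWord, quasiLazyWord, h1, greedyDigit, quasiDigit, ← h2, mul_sub, ← mul_assoc]

theorem isQuasiLazyExpansion_quasiLazyWord (hβ : ∀ n, 1 < β n) (hp1 : 1 ≤ p)
    (hp : ∀ n, β (n + p) = β n) (i : ℕ) :
    IsQuasiLazyExpansion (shiftBase β i) (quasiLazyWord β i 1) := by
  refine tendsto_pi_nhds.2 fun n => tendsto_const_nhds.congr' ?_
  set X := xMax (shiftBase β i)
  have htend : Tendsto (fun x => x - (X - 1)) (𝓝[>] (X - 1)) (𝓝[>] 0) := by
    refine tendsto_nhdsWithin_iff.2 ⟨?_, ?_⟩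
    · have : Tendsto (fun x => x - (X - 1)) (𝓝 (X - 1)) (𝓝 (X - 1 - (X - 1))) :=
        tendsto_id.sub tendsto_const_nhds
      rw [sub_self] at this
      exact this.mono_left nhdsWithin_le_nhds
    · filter_upwards [self_mem_nhdsWithin] with x hx
      exact sub_pos.2 (Set.mem_Ioi.1 hx)
  filter_upwards [htend.eventually (eventually_lazyWord_sub hβ i (r := 1) (by simp) n),
    Ioo_mem_nhdsGT (show X - 1 < X by linarith)] with x h1 hx
  have h2 := lazyExpansion_shiftBase_sub hβ hp1 hp i (y := 1 - (x - (X - 1)))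
    ⟨by linarith [hx.2], by linarith [hx.1]⟩
  rw [← h1, ← h2]
  congr 1
  ring

theorem isQuasiLazyExpansion_iff (hβ : ∀ n, 1 < β n) (hp1 : 1 ≤ p)
    (hp : ∀ n, β (n + p) = β n) (i : ℕ) (a : ℕ → ℕ) :
    IsQuasiLazyExpansion (shiftBase β i) a ↔ a = quasiLazyWord β i 1 := by
  have h := isQuasiLazyExpansion_quasiLazyWord hβ hp1 hp i
  exact ⟨fun ha => tendsto_nhds_unique ha h, fun ha => ha ▸ h⟩

theorem isLazyPrefix_ofFn {i n m : ℕ} {y : ℝ} {a : ℕ → Alphabet β}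
    (h : ∀ k < n, (a (m + k) : ℕ) = lazyWord β i y k) :
    IsLazyPrefix β (List.ofFn fun k : Fin n => a (m + k)) i y := by
  rw [isLazyPrefix_iff_forall]
  intro k hk
  simpa using h k (by simpa using hk)

/-- Cylinders are open, so the closure adds no finite factor; a factor starting at position `m` is a
prefix in the base shifted by `m`, because greedy orbits stay in `[0, 1)`. -/
theorem factorLanguage_lazyShift (hβ : ∀ n, 1 < β n) (hp1 : 1 ≤ p) (hp : ∀ n, β (n + p) = β n) :
    factorLanguage (lazyShift β) = totalLanguage β := by
  have hU : ∀ a, a ∈ lazyUnion β ↔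
      ∃ i, ∃ y ∈ Set.Ico (0 : ℝ) 1, lazyWord β i y = fun k => (a k : ℕ) := by
    intro a
    simp only [lazyUnion, lazyExpansions_shiftBase hβ hp1 hp]
    rfl
  ext w
  constructor
  · rintro ⟨a, ha, m, n, rfl⟩
    have hopen : IsOpen ((Set.Iio (m + n)).pi fun k => ({a k} : Set (Alphabet β))) :=
      isOpen_set_pi (Set.finite_Iio _) fun _ _ => isOpen_discrete _
    obtain ⟨c, hc, hcU⟩ := mem_closure_iff.1 ha _ hopen fun k _ => rfl
    obtain ⟨i, y, hy, h⟩ := (hU c).1 hcU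
    have key : List.ofFn (fun k : Fin (m + n) => a (0 + k)) ∈ prefixLanguage β i 1 := by
      refine ⟨y, hy, hy.2, isLazyPrefix_ofFn fun k hk => ?_⟩
      rw [h, zero_add]
      exact congrArg Subtype.val (hc k hk).symm
    have hsplit : List.ofFn (fun k : Fin (m + n) => a (0 + k)) =
        List.ofFn (fun k : Fin m => a k) ++ List.ofFn (fun k : Fin n => a (m + k)) := by
      simp [List.ofFn_add]
    rw [hsplit] at key
    exact ⟨_, append_mem_prefixLanguage_right hβ key⟩
  · rintro ⟨i, y, hy, -, h⟩
    refine ⟨fun k => ⟨lazyWord β i y k, i + k, Nat.sub_le _ _⟩,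
      subset_closure ((hU _).2 ⟨i, y, hy, rfl⟩), 0, w.length, ?_⟩
    rw [isLazyPrefix_iff_forall] at h
    refine List.ext_getElem (by simp) fun k hk _ => ?_
    rw [List.getElem_ofFn]
    exact Subtype.ext (by simpa using h k hk)

end Expansions

end LazyBeta

theorem mainTheorem2 (β : ℕ → ℝ) (p : ℕ) (hβ : LazyBeta.IsAlternateBase β p) :
    LazyBeta.IsSofic (LazyBeta.lazyShift β) ↔
      ∀ i : ℕ, i < p → ∃ a : ℕ → ℕ,
        LazyBeta.IsQuasiLazyExpansion (LazyBeta.shiftBase β i) a ∧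
          LazyBeta.IsUltimatelyPeriodic a := by
  obtain ⟨⟨hβ1, -⟩, hp1, hp⟩ := hβ
  rw [LazyBeta.IsSofic, LazyBeta.factorLanguage_lazyShift hβ1 hp1 hp,
    LazyBeta.isRegular_totalLanguage_iff hβ1 hp1 hp]
  simp only [LazyBeta.isQuasiLazyExpansion_iff hβ1 hp1 hp, exists_eq_left]
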